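/- All groups and graphs are finite, and graphs are simple. For a graph $\Gamma$ with vertex set $V\Gamma$, a group $G\le\mathrm{Aut}(\Gamma)$ and $v\in V\Gamma$, let $G_v$ be the stabiliser of $v$ in $G$ and let $G_v^{\Gamma(v)}$ be the permutation group that $G_v$ induces on the neighbourhood $\Gamma(v)$. For a permutation group $L$, the pair $(\Gamma,G)$ is called locally-$L$ if $\Gamma$ is connected, $G$ is transitive on $V\Gamma$, and $G_v^{\Gamma(v)}$ is permutation isomorphic to $L$ for every $v\in V\Gamma$. We say that $L$ has exponential graph growth if there are locally-$L$ pairs $(\Gamma_n,G_n)$, $n\in\mathbb N$, with $|V\Gamma_n|\to\infty$, and a constant $c>1$, such that $|(G_n)_v|\ge c^{|V\Gamma_n|}$ for all $n\in\mathbb N$ and all $v\in V\Gamma_n$. Theorem. Let $L$ be a transitive permutation group on a finite set $\Omega$ and let $B$ be a nontrivial block of $L$ (that is, a block with $1<|B|<|\Omega|$) such that the pointwise stabiliser $L_{(\Omega\setminus B)}$ of $\Omega\setminus B$ in $L$ is nontrivial. Then $L$ has exponential graph growth. Moreover, with $k=|B|$, there are locally-$L$ pairs $(\Lambda_n,H_n)$,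 $n\in\mathbb N$, with $|V\Lambda_n|\to\infty$ and $$|(H_n)_v|\ \ge\ |L_{(\Omega\setminus B)}|^{\,|V\Lambda_n|/k-1}\qquad\text{for all } n\in\mathbb N \text{ and all } v\in V\Lambda_n.$$ -/

import Mathlib

namespace GraphGrowth

/-- Permutation groups `L` on `Ω` and `M` on `Δ` are permutation isomorphic if some bijection
`e : Ω ≃ Δ` carries `L` onto `M`, that is, `M = {e ∘ l ∘ e⁻¹ | l ∈ L}`. -/
def PermIsomorphic {Ω Δ : Type*} (L : Subgroup (Equiv.Perm Ω)) (M : Subgroup (Equiv.Perm Δ)) :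
    Prop :=
  ∃ e : Ω ≃ Δ, L.map e.permCongrHom.toMonoidHom = M

/-- The local action of `G ≤ Aut(Γ)` at `v`: the group of all permutations of the neighbourhood
of `v` that are induced by elements of the vertex-stabiliser `G_v`. -/
def localAction {V : Type*} {Γ : SimpleGraph V} (G : Subgroup (Γ ≃g Γ)) (v : V) :
    Subgroup (Equiv.Perm (Γ.neighborSet v)) where
  carrier := {σ | ∃ g ∈ G, g v = v ∧ ∀ w : Γ.neighborSet v, ((σ w : Γ.neighborSet v) : V) = g w}
  one_mem' := ⟨1, G.one_mem, rfl, fun _ => rfl⟩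
  mul_mem' := by
    rintro σ τ ⟨g, hg, hgv, hσ⟩ ⟨h, hh, hhv, hτ⟩
    refine ⟨g * h, G.mul_mem hg hh, ?_, fun w => ?_⟩
    · rw [RelIso.mul_apply, hhv, hgv]
    · rw [Equiv.Perm.mul_apply, hσ, hτ, RelIso.mul_apply]
  inv_mem' := by
    rintro σ ⟨g, hg, hgv, hσ⟩
    refine ⟨g⁻¹, G.inv_mem hg, ?_, fun w => ?_⟩
    · apply g.injective
      rw [RelIso.apply_inv_self, hgv]
    · apply g.injective
      rw [RelIso.apply_inv_self, ← hσ]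
      simp

/-- `(Γ, G)` is a locally-`L` pair: `Γ` is a finite connected (simple) graph, `G ≤ Aut(Γ)` is
transitive on the vertices, and the local action of `G` at each vertex is permutation isomorphic
to `L`. -/
structure IsLocallyPair {Ω V : Type*} (L : Subgroup (Equiv.Perm Ω)) (Γ : SimpleGraph V)
    (G : Subgroup (Γ ≃g Γ)) : Prop where
  finite : Finite V
  connected : Γ.Connected
  vertexTransitive : MulAction.IsPretransitive G V
  local_iso : ∀ v : V, PermIsomorphic (localAction G v) L

/-- `L` has exponential graph growth: there are locally-`L` pairs `(Γ_n, G_n)` with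
`|VΓ_n| → ∞` and a constant `c > 1` such that `|(G_n)_v| ≥ c ^ |VΓ_n|` for all `n` and `v`.
(A finite graph is isomorphic to one whose vertex type lives in `Type`.) -/
def HasExponentialGraphGrowth {Ω : Type*} (L : Subgroup (Equiv.Perm Ω)) : Prop :=
  ∃ (V : ℕ → Type) (Γ : (n : ℕ) → SimpleGraph (V n)) (G : (n : ℕ) → Subgroup (Γ n ≃g Γ n)),
    (∀ n, IsLocallyPair L (Γ n) (G n)) ∧
    Filter.Tendsto (fun n => Nat.card (V n)) Filter.atTop Filter.atTop ∧
    ∃ c : ℝ, 1 < c ∧ ∀ (n : ℕ) (v : V n),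
      c ^ Nat.card (V n) ≤ (Nat.card (MulAction.stabilizer (G n) v) : ℝ)

end GraphGrowth

/-!
Let `J` be the block system containing `B`, and let `S` be a graph with vertices coloured by `J`,
every block occurring exactly once on each neighbourhood. Replacing each vertex of `S` by the block
that colours it turns neighbourhoods into copies of `Ω`. If `S` is bipartite and every permutation
of `J` lifts to `S`, independently on the two parts, then the automorphisms of the blow-up inducing
elements of `L` on all neighbourhoods have local action `L`. Over each single vertex of `S` one may
moreover act by an arbitrary element of the pointwise stabiliser of the complement of its block:
such elements for different blocks combine to one element of `L`. This gives
`|L_(Ω \ B)| ^ (|S| - 1)` automorphisms fixing a vertex, while the blow-up has `k |S|` vertices.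

Arbitrarily large such `S` are covers of the complete bipartite graph `K_{J,J}` whose voltages are
the classes of the edges in the first cohomology group over `ℤ/q`, that is, in the `J × J` matrices
modulo those of the form `f a + g b`. These classes are permuted by all automorphisms of `K_{J,J}`,
and they sum to zero at each vertex. Summing the voltages of the closed walks of length four
through an edge therefore yields `|J|²` times the class of that edge, so the cover is connected when
`|J|` is invertible modulo `q`.
-/

namespace GraphGrowth

open MulAction

universe u

/-- A homogeneous colouring of a graph `S`: a (not necessarily proper) vertex colouring `c` using
every colour exactly once on each neighbourhood, together with a bipartition `p`, such that the
colours can be permuted independently in the two parts by automorphisms of `S`, and the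
colour-preserving automorphisms are transitive on each colour class. -/
structure IsHomogeneousColoring {U J : Type*} {S : SimpleGraph U} (c : U → J)
    (p : S.Coloring Bool) : Prop where
  connected : S.Connected
  bijOn (u : U) : Set.BijOn c (S.neighborSet u) Set.univ
  exists_perm (σ : Bool → Equiv.Perm J) : ∃ g : S ≃g S, ∀ u, c (g u) = σ (p u) (c u)
  exists_apply_eq {u u' : U} (h : c u = c u') : ∃ g : S ≃g S, g u = u' ∧ ∀ w, c (g w) = c w

theorem IsHomogeneousColoring.exists_perm_apply_eq {U J : Type*} {S : SimpleGraph U} {c : U → J}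
    {p : S.Coloring Bool} (hc : IsHomogeneousColoring c p) {u u' : U} (σ : Bool → Equiv.Perm J)
    (h : σ (p u) (c u) = c u') :
    ∃ g : S ≃g S, g u = u' ∧ ∀ w, c (g w) = σ (p w) (c w) := by
  obtain ⟨g, hg⟩ := hc.exists_perm σ
  obtain ⟨t, htu, ht⟩ := hc.exists_apply_eq ((hg u).trans h)
  exact ⟨t * g, htu, fun w => (ht (g w)).trans (hg w)⟩

section CoverGraph

variable {J X : Type*} [AddCommGroup X]

/-- The cover of the complete bipartite graph on `J × Bool` derived from a voltage assignment
`s : J → J → X`. A vertex `(x, a, true)` stands for the point `-x` of the fibre over `(a, true)`;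
with this sign the adjacency relation `x + y = s a b` is symmetric in the two parts. -/
def coverGraph (s : J → J → X) : SimpleGraph (X × J × Bool) where
  Adj v w := w.2.2 = !v.2.2 ∧
    v.1 + w.1 = bif v.2.2 then s w.2.1 v.2.1 else s v.2.1 w.2.1
  symm := ⟨by
    rintro ⟨x, a, i⟩ ⟨y, b, _⟩ ⟨rfl, h⟩
    cases i <;> simpa [add_comm] using h⟩
  loopless := ⟨by
    rintro ⟨x, a, i⟩ ⟨h, -⟩
    simp at h⟩

variable {s : J → J → X}

theorem coverGraph_adj_false_true {x y : X} {a b : J} :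
    (coverGraph s).Adj (x, a, false) (y, b, true) ↔ x + y = s a b := by
  simp [coverGraph]

/-- The bipartition of the derived cover. -/
def coverPart (s : J → J → X) : (coverGraph s).Coloring Bool :=
  SimpleGraph.Coloring.mk (fun v => v.2.2) fun {v w} h => by
    rw [h.1]
    simp

theorem coverGraph_bijOn (v : X × J × Bool) :
    Set.BijOn (fun w : X × J × Bool => w.2.1) ((coverGraph s).neighborSet v) Set.univ := by
  obtain ⟨x, a, i⟩ := v
  refine ⟨Set.mapsTo_univ _ _, ?_, fun b _ => ?_⟩
  · rintro ⟨y, b, _⟩ ⟨rfl, h⟩ ⟨z, _, _⟩ ⟨rfl, h'⟩ rfl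
    exact Prod.ext (add_left_cancel (h.trans h'.symm)) rfl
  · exact ⟨((bif i then s b a else s a b) - x, b, !i), ⟨rfl, add_sub_cancel _ _⟩, rfl⟩

theorem coverGraph_connected [Nonempty J]
    (hs : AddSubgroup.closure {x | ∃ a a' b b', x = s a b - s a' b + s a' b' - s a b'} = ⊤) :
    (coverGraph s).Connected := by
  have two_step (x : X) (a a' b : J) :
      (coverGraph s).Reachable (x, a, false) (x - s a b + s a' b, a', false) := by
    have h : (coverGraph s).Adj (x, a, false) (s a b - x, b, true) :=
      coverGraph_adj_false_true.2 (add_sub_cancel _ _)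
    have h' : (coverGraph s).Adj (x - s a b + s a' b, a', false) (s a b - x, b, true) :=
      coverGraph_adj_false_true.2 (by abel)
    exact h.reachable.trans h'.symm.reachable
  have translate (x g : X) (a₀ : J) :
      (coverGraph s).Reachable (x, a₀, false) (x + g, a₀, false) := by
    have hg := hs ▸ AddSubgroup.mem_top g
    induction hg using AddSubgroup.closure_induction generalizing x with
    | mem g hg =>
      obtain ⟨a, a', b, b', rfl⟩ := hg
      have h := (two_step x a₀ a b).trans <| (two_step _ a a' b').trans <|
        (two_step _ a' a b).trans <| two_step _ a a₀ b
      convert h using 2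
      abel
    | zero => simp
    | add g g' _ _ hg hg' => exact add_assoc x g g' ▸ (hg x).trans (hg' (x + g))
    | neg g _ hg => simpa using (hg (x + -g)).symm
  obtain ⟨a₀⟩ := ‹Nonempty J›
  have from_base (x : X) (a : J) : (coverGraph s).Reachable (0, a₀, false) (x, a, false) := by
    simpa using (translate 0 (x - s a a₀ + s a₀ a₀) a₀).trans (two_step _ a₀ a a₀)
  refine (SimpleGraph.connected_iff_exists_forall_reachable _).2 ⟨(0, a₀, false), ?_⟩
  rintro ⟨x, a, _ | _⟩
  · exact from_base x a
  · exact (from_base (s a₀ a - x) a₀).trans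
      (coverGraph_adj_false_true.2 (sub_add_cancel _ _)).reachable

/-- The lift to the derived cover of a permutation of the vertices of the complete bipartite graph
preserving the two parts. -/
def coverPermIso (σ : Bool → Equiv.Perm J) (ρ : X ≃+ X)
    (hρ : ∀ a b, ρ (s a b) = s (σ false a) (σ true b)) : coverGraph s ≃g coverGraph s where
  toFun v := (ρ v.1, σ v.2.2 v.2.1, v.2.2)
  invFun v := (ρ.symm v.1, (σ v.2.2).symm v.2.1, v.2.2)
  left_inv v := by simp
  right_inv v := by simp
  map_rel_iff' := by
    have key (x y z : X) : ρ x + ρ y = ρ z ↔ x + y = z := by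
      rw [← map_add, ρ.injective.eq_iff]
    rintro ⟨x, a, _ | _⟩ ⟨y, b, _ | _⟩ <;> simp [coverGraph, ← hρ, key]

/-- The lift to the derived cover of the automorphism of the complete bipartite graph that exchanges
the two copies of `J`. -/
def coverSwapIso (τ : X ≃+ X) (hτ : ∀ a b, τ (s a b) = s b a) :
    coverGraph s ≃g coverGraph s where
  toFun v := (τ v.1, v.2.1, !v.2.2)
  invFun v := (τ.symm v.1, v.2.1, !v.2.2)
  left_inv v := by simp
  right_inv v := by simp
  map_rel_iff' := by
    have key (x y : X) (a b : J) : τ x + τ y = s b a ↔ x + y = s a b := by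
      rw [← hτ, ← map_add, τ.injective.eq_iff]
    rintro ⟨x, a, _ | _⟩ ⟨y, b, _ | _⟩ <;> simp [coverGraph, key]

/-- The covering transformation of the derived cover given by `t : X`. -/
def coverTranslation (s : J → J → X) (t : X) : coverGraph s ≃g coverGraph s where
  toFun v := (bif v.2.2 then v.1 - t else v.1 + t, v.2)
  invFun v := (bif v.2.2 then v.1 + t else v.1 - t, v.2)
  left_inv := by rintro ⟨x, a, _ | _⟩ <;> simp
  right_inv := by rintro ⟨x, a, _ | _⟩ <;> simp
  map_rel_iff' := by
    rintro ⟨x, a, _ | _⟩ ⟨y, b, _ | _⟩ <;> simp [coverGraph]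

theorem exists_coverTranslation_apply_eq (s : J → J → X) (x y : X) (u : J × Bool) :
    ∃ t, coverTranslation s t (x, u) = (y, u) := by
  obtain ⟨a, _ | _⟩ := u
  · exact ⟨y - x, by simp [coverTranslation]⟩
  · exact ⟨x - y, by simp [coverTranslation]⟩

theorem isHomogeneousColoring_coverPart [Nonempty J]
    (hperm : ∀ σ σ' : Equiv.Perm J, ∃ ρ : X ≃+ X, ∀ a b, ρ (s a b) = s (σ a) (σ' b))
    (hswap : ∃ τ : X ≃+ X, ∀ a b, τ (s a b) = s b a)
    (hs : AddSubgroup.closure {x | ∃ a a' b b', x = s a b - s a' b + s a' b' - s a b'} = ⊤) :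
    IsHomogeneousColoring (fun v => v.2.1) (coverPart s) where
  connected := coverGraph_connected hs
  bijOn := coverGraph_bijOn
  exists_perm σ := by
    obtain ⟨ρ, hρ⟩ := hperm (σ false) (σ true)
    exact ⟨coverPermIso σ ρ hρ, fun _ => rfl⟩
  exists_apply_eq := by
    rintro ⟨x, a, i⟩ ⟨y, _, i'⟩ rfl
    obtain rfl | rfl : i' = i ∨ i' = !i := by cases i <;> cases i' <;> simp
    · obtain ⟨t, ht⟩ := exists_coverTranslation_apply_eq s x y (a, i')
      exact ⟨coverTranslation s t, ht, fun _ => rfl⟩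
    · obtain ⟨τ, hτ⟩ := hswap
      obtain ⟨t, ht⟩ := exists_coverTranslation_apply_eq s (τ x) y (a, !i)
      exact ⟨coverTranslation s t * coverSwapIso τ hτ, ht, fun _ => rfl⟩

end CoverGraph

section EdgeClass

variable {J R : Type*} [CommRing R]

/-- The matrices of the form `M a b = f a + g b`. Viewing matrices as functions on the edges of the
complete bipartite graph, these are the coboundaries (up to a sign in one part). -/
def separable (J R : Type*) [CommRing R] : Submodule R (Matrix J J R) where
  carrier := {M | ∀ a a' b b', M a b + M a' b' = M a' b + M a b'}
  zero_mem' := by simp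
  add_mem' hM hN a a' b b' := by
    simp only [Matrix.add_apply]
    linear_combination hM a a' b b' + hN a a' b b'
  smul_mem' r M hM a a' b b' := by
    simp only [Matrix.smul_apply, smul_eq_mul]
    linear_combination r * hM a a' b b'

theorem map_reindex_separable (σ σ' : Equiv.Perm J) :
    (separable J R).map (Matrix.reindexLinearEquiv R R σ σ' : Matrix J J R →ₗ[R] Matrix J J R) =
      separable J R := by
  refine le_antisymm (Submodule.map_le_iff_le_comap.2 fun M hM a a' b b' => hM _ _ _ _)
    fun M hM => ⟨M.submatrix σ σ', fun a a' b b' => hM _ _ _ _, by simp⟩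

theorem map_transpose_separable :
    (separable J R).map (Matrix.transposeLinearEquiv J J R R : Matrix J J R →ₗ[R] Matrix J J R) =
      separable J R := by
  have key (M : Matrix J J R) (hM : M ∈ separable J R) : M.transpose ∈ separable J R :=
    fun a a' b b' => by simpa [add_comm] using hM b b' a a'
  exact le_antisymm (Submodule.map_le_iff_le_comap.2 key) fun M hM => ⟨_, key M hM, rfl⟩

variable [DecidableEq J]

/-- The class of the edge `(a, b)` of the complete bipartite graph modulo `separable`. -/
def edgeClass (R : Type*) [CommRing R] (a b : J) : Matrix J J R ⧸ separable J R :=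
  (separable J R).mkQ (Matrix.single a b 1)

theorem exists_addEquiv_edgeClass_perm (σ σ' : Equiv.Perm J) :
    ∃ ρ : (Matrix J J R ⧸ separable J R) ≃+ (Matrix J J R ⧸ separable J R),
      ∀ a b, ρ (edgeClass R a b) = edgeClass R (σ a) (σ' b) :=
  ⟨(Submodule.Quotient.equiv _ _ _ (map_reindex_separable σ σ')).toAddEquiv, fun a b => by
    simp [edgeClass]⟩

theorem exists_addEquiv_edgeClass_swap :
    ∃ τ : (Matrix J J R ⧸ separable J R) ≃+ (Matrix J J R ⧸ separable J R),
      ∀ a b : J, τ (edgeClass R a b) = edgeClass R b a :=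
  ⟨(Submodule.Quotient.equiv _ _ _ map_transpose_separable).toAddEquiv, fun a b => by
    simp [edgeClass]⟩

theorem smul_edgeClass_injective [Nontrivial J] (a : J) :
    Function.Injective fun r : R => r • edgeClass R a a := by
  intro r r' h
  obtain ⟨b, hb⟩ := exists_ne a
  have hmem : r • Matrix.single a a (1 : R) - r' • Matrix.single a a 1 ∈ separable J R :=
    (Submodule.Quotient.eq _).1 h
  simpa [hb, hb.symm, sub_eq_zero] using hmem a b a b

variable [Fintype J]

theorem sum_edgeClass_left (b : J) : ∑ a, edgeClass R a b = 0 := by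
  simp only [edgeClass, ← map_sum]
  refine (Submodule.Quotient.mk_eq_zero _).2 fun a a' b' b'' => ?_
  simp [Matrix.sum_apply, Matrix.single_apply, ite_and]

theorem sum_edgeClass_right (a : J) : ∑ b, edgeClass R a b = 0 := by
  obtain ⟨τ, hτ⟩ := exists_addEquiv_edgeClass_swap (J := J) (R := R)
  simpa [hτ] using congrArg τ (sum_edgeClass_left a)

theorem sum_alternating_edgeClass (a b : J) :
    ∑ a', ∑ b', (edgeClass R a b - edgeClass R a' b + edgeClass R a' b' - edgeClass R a b') =
      (Fintype.card J * Fintype.card J : R) • edgeClass R a b := by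
  simp [Finset.sum_add_distrib, Finset.sum_sub_distrib, sum_edgeClass_right, ← Finset.smul_sum,
    sum_edgeClass_left, mul_smul, Nat.cast_smul_eq_nsmul]

theorem closure_alternating_edgeClass_eq_top {q : ℕ} (hq : IsUnit (Fintype.card J : ZMod q)) :
    AddSubgroup.closure {x | ∃ a a' b b' : J, x = edgeClass (ZMod q) a b - edgeClass (ZMod q) a' b
      + edgeClass (ZMod q) a' b' - edgeClass (ZMod q) a b'} = ⊤ := by
  set C := AddSubgroup.closure {x | ∃ a a' b b' : J, x = edgeClass (ZMod q) a b
    - edgeClass (ZMod q) a' b + edgeClass (ZMod q) a' b' - edgeClass (ZMod q) a b'}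
  have edgeClass_mem (a b : J) : edgeClass (ZMod q) a b ∈ C := by
    obtain ⟨t, ht⟩ := (hq.mul hq).exists_left_inv
    have hsum : (Fintype.card J * Fintype.card J : ZMod q) • edgeClass (ZMod q) a b ∈ C := by
      rw [← sum_alternating_edgeClass]
      exact sum_mem fun a' _ => sum_mem fun b' _ =>
        AddSubgroup.subset_closure ⟨a, a', b, b', rfl⟩
    simpa [smul_smul, ht] using ZMod.smul_mem hsum t
  refine (AddSubgroup.eq_top_iff' _).2 fun x => ?_
  obtain ⟨M, rfl⟩ := Submodule.mkQ_surjective _ x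
  rw [Matrix.matrix_eq_sum_single M, map_sum]
  simp only [map_sum]
  refine sum_mem fun a _ => sum_mem fun b _ => ?_
  have h := ZMod.smul_mem (edgeClass_mem a b) (M a b)
  rwa [edgeClass, ← map_smul, Matrix.smul_single, smul_eq_mul, mul_one] at h

end EdgeClass

theorem exists_isHomogeneousColoring (J : Type u) [Finite J] [Nontrivial J] (n : ℕ) :
    ∃ (U : Type u) (S : SimpleGraph U) (c : U → J) (p : S.Coloring Bool),
      Finite U ∧ n ≤ Nat.card U ∧ IsHomogeneousColoring c p := by
  classical
  have := Fintype.ofFinite J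
  let q := Fintype.card J * n + 1
  have hq : IsUnit (Fintype.card J : ZMod q) :=
    (ZMod.isUnit_iff_coprime _ _).2 (by simp [q])
  let X := Matrix J J (ZMod q) ⧸ separable J (ZMod q)
  have : Finite X := Quotient.finite _
  obtain ⟨a⟩ := ‹Nontrivial J›.to_nonempty
  refine ⟨X × J × Bool, coverGraph (edgeClass (ZMod q)), _, coverPart _, inferInstance, ?_,
    isHomogeneousColoring_coverPart exists_addEquiv_edgeClass_perm exists_addEquiv_edgeClass_swap
      (closure_alternating_edgeClass_eq_top hq)⟩
  calc n ≤ q := Nat.le_succ_of_le (Nat.le_mul_of_pos_left n Fintype.card_pos)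
    _ = Nat.card (ZMod q) := (Nat.card_zmod q).symm
    _ ≤ Nat.card (X × J × Bool) := Nat.card_le_card_of_injective
      (fun r => (r • edgeClass (ZMod q) a a, a, false)) fun r r' h =>
        smul_edgeClass_injective a (congrArg Prod.fst h)

section Blowup

variable {U J Ω A : Type*} {S : SimpleGraph U} {c : U → J}

/-- The blow-up of `S` along `π`, in which every vertex `u` is replaced by the fibre of `π` over its
colour `c u`. -/
def blowup (S : SimpleGraph U) (c : U → J) (π : Ω → J) : SimpleGraph (c.Pullback π) :=
  S.comap Function.Pullback.fst

theorem blowup_connected {π : Ω → J} [Nonempty J] (hS : S.Connected)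
    (hc : ∀ u, Set.BijOn c (S.neighborSet u) Set.univ) (hπ : Function.Surjective π) :
    (blowup S c π).Connected := by
  have exists_lift (u : U) : ∃ v : c.Pullback π, v.fst = u :=
    let ⟨ω, hω⟩ := hπ (c u)
    ⟨⟨(u, ω), hω.symm⟩, rfl⟩
  have of_fst_eq (v w : c.Pullback π) (h : v.fst = w.fst) : (blowup S c π).Reachable v w := by
    obtain ⟨u, hu, -⟩ := (hc v.fst).surjOn (Set.mem_univ (Classical.arbitrary J))
    obtain ⟨z, rfl⟩ := exists_lift u
    have hvz : (blowup S c π).Adj v z := hu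
    have hwz : (blowup S c π).Adj w z := show S.Adj w.fst z.fst from h ▸ hu
    exact hvz.reachable.trans hwz.symm.reachable
  have of_walk {u u' : U} (P : S.Walk u u') : ∀ v w : c.Pullback π, v.fst = u → w.fst = u' →
      (blowup S c π).Reachable v w := by
    induction P with
    | nil => exact fun v w hv hw => of_fst_eq v w (hv.trans hw.symm)
    | @cons u u'' _ h _ ih =>
      rintro v w rfl hw
      obtain ⟨z, rfl⟩ := exists_lift u''
      exact (show (blowup S c π).Adj v z from h).reachable.trans (ih z w rfl hw)
  have := hS.nonempty
  obtain ⟨v, -⟩ := exists_lift (Classical.arbitrary U)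
  have : Nonempty (c.Pullback π) := ⟨v⟩
  exact ⟨fun v w => (hS v.fst w.fst).elim fun P => of_walk P v w rfl rfl⟩

/-- The identification of a neighbourhood in the blow-up with `Ω`. -/
noncomputable def blowupNeighborEquiv (hc : ∀ u, Set.BijOn c (S.neighborSet u) Set.univ)
    (π : Ω → J) (v : c.Pullback π) : (blowup S c π).neighborSet v ≃ Ω :=
  Equiv.ofBijective (fun w => w.1.snd) <| by
    refine ⟨?_, fun ω => ?_⟩
    · rintro ⟨⟨⟨u, ω⟩, h⟩, hu⟩ ⟨⟨⟨u', _⟩, h'⟩, hu'⟩ rfl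
      obtain rfl : u = u' := (hc v.fst).injOn hu hu' (h.trans h'.symm)
      rfl
    · obtain ⟨u, hu, h⟩ := (hc v.fst).surjOn (Set.mem_univ (π ω))
      exact ⟨⟨⟨(u, ω), h⟩, hu⟩, rfl⟩

variable [Group A] [MulAction A Ω] [MulAction A J] {π : Ω →[A] J}

/-- The lift to the blow-up of an automorphism `g` of `S`, acting by `l u` on the fibre over `u`. -/
def blowupLift (π : Ω →[A] J) (g : S ≃g S) (l : U → A) (hl : ∀ u, c (g u) = l u • c u) :
    blowup S c π ≃g blowup S c π where
  toFun v := ⟨(g v.fst, l v.fst • v.snd), by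
    rw [hl, map_smul]
    exact congrArg _ v.2⟩
  invFun v := ⟨(g.symm v.fst, (l (g.symm v.fst))⁻¹ • v.snd), by
    rw [map_smul, eq_inv_smul_iff, ← hl, g.apply_symm_apply]
    exact v.2⟩
  left_inv v := Subtype.ext (Prod.ext (g.symm_apply_apply _) (by
    simp [Function.Pullback.fst, Function.Pullback.snd]))
  right_inv v := Subtype.ext (Prod.ext (g.apply_symm_apply _) (smul_inv_smul _ _))
  map_rel_iff' := g.map_rel_iff

variable (A S c π) in
/-- The automorphisms of the blow-up that induce an element of `A` on each neighbourhood. -/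
def blowupGroup : Subgroup (blowup S c π ≃g blowup S c π) where
  carrier := {g | ∀ v, ∃ a : A, ∀ w, (blowup S c π).Adj v w → (g w).snd = a • w.snd}
  one_mem' v := ⟨1, fun _ _ => (one_smul _ _).symm⟩
  mul_mem' := by
    intro g h hg hh v
    obtain ⟨a, ha⟩ := hh v
    obtain ⟨b, hb⟩ := hg (h v)
    refine ⟨b * a, fun w hw => ?_⟩
    rw [RelIso.mul_apply, hb _ (h.map_rel_iff.2 hw), ha w hw, mul_smul]
  inv_mem' := by
    intro g hg v
    obtain ⟨a, ha⟩ := hg (g⁻¹ v)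
    refine ⟨a⁻¹, fun w hw => ?_⟩
    have h := ha (g⁻¹ w) (g⁻¹.map_rel_iff.2 hw)
    rw [RelIso.apply_inv_self] at h
    rw [eq_inv_smul_iff, h]

theorem blowupLift_mem_blowupGroup {g : S ≃g S} {l : U → A} (hl : ∀ u, c (g u) = l u • c u)
    (h : ∀ u, ∃ a : A, ∀ w, S.Adj u w → ∀ ω, π ω = c w → l w • ω = a • ω) :
    blowupLift π g l hl ∈ blowupGroup A S c π := fun v =>
  let ⟨a, ha⟩ := h v.fst
  ⟨a, fun w hw => ha w.fst hw w.snd w.2.symm⟩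

section Homogeneous

variable {p : S.Coloring Bool}

theorem IsHomogeneousColoring.exists_mem_blowupGroup (hc : IsHomogeneousColoring c p) {u u' : U}
    (a : Bool → A) (h : a (p u) • c u = c u') :
    ∃ g ∈ blowupGroup A S c π, (∀ v, v.fst = u → (g v).fst = u') ∧
      ∀ v, (g v).snd = a (p v.fst) • v.snd := by
  obtain ⟨g, rfl, hg⟩ := hc.exists_perm_apply_eq (fun i => MulAction.toPerm (a i)) h
  refine ⟨blowupLift π g (fun u => a (p u)) hg,
    blowupLift_mem_blowupGroup hg fun u => ⟨a !p u, fun w hw ω _ => ?_⟩,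
    fun v hv => congrArg g hv, fun _ => rfl⟩
  rw [Bool.eq_not.2 (p.valid hw).symm]

theorem IsHomogeneousColoring.isPretransitive_blowupGroup [IsPretransitive A Ω]
    (hc : IsHomogeneousColoring c p) :
    IsPretransitive (blowupGroup A S c π) (c.Pullback π) := by
  refine ⟨fun v w => ?_⟩
  obtain ⟨a, ha⟩ := exists_smul_eq A v.snd w.snd
  have hfst : a • c v.fst = c w.fst :=
    calc a • c v.fst = a • π v.snd := congrArg _ v.2
      _ = π w.snd := by rw [← map_smul, ha]
      _ = c w.fst := w.2.symm
  obtain ⟨g, hg, h, h'⟩ := hc.exists_mem_blowupGroup (π := π) (fun _ => a) hfst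
  exact ⟨⟨g, hg⟩, Subtype.ext (Prod.ext (h v rfl) ((h' v).trans ha))⟩

theorem IsHomogeneousColoring.permIsomorphic_localAction_blowupGroup
    (hc : IsHomogeneousColoring c p) (v : c.Pullback π) :
    PermIsomorphic (localAction (blowupGroup A S c π) v) (toPermHom A Ω).range := by
  classical
  let e := blowupNeighborEquiv hc.bijOn π v
  refine ⟨e, le_antisymm ?_ ?_⟩
  · rintro _ ⟨τ, ⟨g, hg, -, hτ⟩, rfl⟩
    obtain ⟨a, ha⟩ := hg v
    refine ⟨a, Equiv.ext fun ω => ?_⟩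
    obtain ⟨w, rfl⟩ := e.surjective ω
    calc a • e w = (g w).snd := (ha w.1 w.2).symm
      _ = e (τ w) := congrArg Function.Pullback.snd (hτ w).symm
      _ = e (τ (e.symm (e w))) := by rw [e.symm_apply_apply]
  · rintro _ ⟨a, rfl⟩
    obtain ⟨g, hg, hfst, hsnd⟩ := hc.exists_mem_blowupGroup (π := π) (u := v.fst) (u' := v.fst)
      (fun i => if i = p v.fst then (1 : A) else a) (by simp)
    have hgv : g v = v := Subtype.ext <| Prod.ext (hfst v rfl) <| (hsnd v).trans <| by
      simp [Function.Pullback.snd]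
    refine ⟨e.symm.permCongr (toPerm a), ⟨g, hg, hgv, fun w => ?_⟩, ?_⟩
    · have hgw : (blowup S c π).Adj v (g w) := by simpa [hgv] using g.map_rel_iff.2 w.2
      have hsndw : (g w).snd = a • e w := by
        rw [hsnd, if_neg (p.valid w.2).symm]
        rfl
      suffices h : e.symm (a • e w) = ⟨g w, hgw⟩ from congrArg Subtype.val h
      rw [e.symm_apply_eq]
      exact hsndw.symm
    · ext
      simp [Equiv.permCongrHom]

theorem IsHomogeneousColoring.isLocallyPair_blowupGroup [Finite U] [Finite Ω] [Nonempty Ω]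
    [IsPretransitive A Ω] (hc : IsHomogeneousColoring c p) (hπ : Function.Surjective π) :
    IsLocallyPair (toPermHom A Ω).range (blowup S c π) (blowupGroup A S c π) where
  finite := inferInstance
  connected :=
    have : Nonempty J := Nonempty.map π ‹_›
    blowup_connected hc.connected hc.bijOn hπ
  vertexTransitive := hc.isPretransitive_blowupGroup
  local_iso := hc.permIsomorphic_localAction_blowupGroup

end Homogeneous

theorem smul_map_eq_of_mem_fixingSubgroup_compl {j : J} {a : A}
    (ha : a ∈ fixingSubgroup A (π ⁻¹' {j})ᶜ) (ω : Ω) : a • π ω = π ω := by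
  rw [mem_fixingSubgroup_iff] at ha
  rw [← map_smul]
  by_cases hω : π ω = j
  · by_contra h
    exact h (congrArg π (MulAction.injective a (ha (a • ω) (hω ▸ h))))
  · rw [ha ω hω]

theorem exists_smul_eq_smul_of_mem_fixingSubgroup_compl [Finite J] {d : J → A}
    (hd : ∀ j, d j ∈ fixingSubgroup A (π ⁻¹' {j})ᶜ) : ∃ a : A, ∀ ω, a • ω = d (π ω) • ω := by
  classical
  have := Fintype.ofFinite J
  have hfix (j : J) (ω : Ω) (hω : π ω ≠ j) : d j • ω = ω := (mem_fixingSubgroup_iff A).1 (hd j) ω hω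
  have partial_glue (T : Finset J) :
      ∃ a : A, ∀ ω, a • ω = if π ω ∈ T then d (π ω) • ω else ω := by
    induction T using Finset.induction_on with
    | empty => exact ⟨1, by simp⟩
    | insert j T hj ih =>
      obtain ⟨a, ha⟩ := ih
      refine ⟨d j * a, fun ω => ?_⟩
      rw [mul_smul, ha]
      by_cases hω : π ω = j
      · simp [hω, hj]
      · have hω' : π (d (π ω) • ω) ≠ j := by
          rwa [map_smul, smul_map_eq_of_mem_fixingSubgroup_compl (hd _)]
        by_cases hT : π ω ∈ T <;> simp [hT, hω, hfix j _ hω, hfix j _ hω']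
  simpa using partial_glue Finset.univ

theorem card_fixingSubgroup_compl_fiber [IsPretransitive A J] (i j : J) :
    Nat.card (fixingSubgroup A (π ⁻¹' {i})ᶜ) = Nat.card (fixingSubgroup A (π ⁻¹' {j})ᶜ) := by
  obtain ⟨a, rfl⟩ := exists_smul_eq A i j
  refine Nat.card_congr (SubMulAction.fixingSubgroupEquivFixingSubgroup (g := a) ?_).toEquiv
  rw [Set.smul_set_compl, ← Group.preimage_smul_set, Set.smul_set_singleton]

theorem ncard_fiber [IsPretransitive A J] (i j : J) : (π ⁻¹' {i}).ncard = (π ⁻¹' {j}).ncard := by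
  obtain ⟨a, rfl⟩ := exists_smul_eq A i j
  rw [← Set.smul_set_singleton, Group.preimage_smul_set, Set.ncard_smul_set]

theorem card_pullback [Finite U] [Finite Ω] [IsPretransitive A J] (c : U → J) (π : Ω →[A] J)
    (j : J) : Nat.card (c.Pullback π) = Nat.card U * (π ⁻¹' {j}).ncard := by
  have := Fintype.ofFinite U
  have hfiber (u : U) : Nat.card {ω // c u = π ω} = (π ⁻¹' {j}).ncard := by
    rw [ncard_fiber j (c u)]
    exact Nat.card_congr (Equiv.subtypeEquivRight fun ω => eq_comm)
  rw [Nat.card_congr (Equiv.subtypeProdEquivSigmaSubtype fun u ω => c u = π ω), Nat.card_sigma]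
  simp [hfiber]

theorem blowupLift_refl_mem_blowupGroup [Finite J]
    (hc : ∀ u, Set.BijOn c (S.neighborSet u) Set.univ) {l : U → A} (hl : ∀ u, c u = l u • c u)
    (hfix : ∀ u, l u ∈ fixingSubgroup A (π ⁻¹' {c u})ᶜ) :
    blowupLift π (RelIso.refl S.Adj) l hl ∈ blowupGroup A S c π := by
  refine blowupLift_mem_blowupGroup hl fun u => ?_
  choose w hw hcw using fun j => (hc u).surjOn (Set.mem_univ j)
  obtain ⟨a, ha⟩ := exists_smul_eq_smul_of_mem_fixingSubgroup_compl (π := π) (d := fun j => l (w j))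
    fun j => by simpa only [hcw] using hfix (w j)
  refine ⟨a, fun w' hw' ω hω => ?_⟩
  rw [ha, hω, (hc u).injOn (hw (c w')) hw' (hcw _)]

theorem blowupLift_refl_injective [FaithfulSMul A Ω] {l l' : U → A} (hl : ∀ u, c u = l u • c u)
    (hl' : ∀ u, c u = l' u • c u) (hfix : ∀ u, l u ∈ fixingSubgroup A (π ⁻¹' {c u})ᶜ)
    (hfix' : ∀ u, l' u ∈ fixingSubgroup A (π ⁻¹' {c u})ᶜ)
    (h : blowupLift π (RelIso.refl S.Adj) l hl = blowupLift π (RelIso.refl S.Adj) l' hl') :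
    l = l' := by
  funext u
  refine FaithfulSMul.eq_of_smul_eq_smul (α := Ω) fun ω => ?_
  by_cases hω : π ω = c u
  · exact congrArg Function.Pullback.snd (DFunLike.congr_fun h ⟨(u, ω), hω.symm⟩)
  · rw [(mem_fixingSubgroup_iff A).1 (hfix u) ω hω, (mem_fixingSubgroup_iff A).1 (hfix' u) ω hω]

theorem pow_le_card_stabilizer_blowupGroup [Finite U] [Finite J] [Finite Ω] [FaithfulSMul A Ω]
    [IsPretransitive A J] (hc : ∀ u, Set.BijOn c (S.neighborSet u) Set.univ)
    (hπ : Function.Surjective π) (j : J) (v : c.Pullback π) :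
    Nat.card (fixingSubgroup A (π ⁻¹' {j})ᶜ) ^ (Nat.card U - 1) ≤
      Nat.card (stabilizer (blowupGroup A S c π) v) := by
  classical
  have := Fintype.ofFinite U
  let l (f : ∀ u : {u // u ≠ v.fst}, fixingSubgroup A (π ⁻¹' {c u})ᶜ) (u : U) : A :=
    if h : u = v.fst then 1 else f ⟨u, h⟩
  have hfix (f) (u) : l f u ∈ fixingSubgroup A (π ⁻¹' {c u})ᶜ := by
    by_cases h : u = v.fst
    · simp [l, h, one_mem]
    · simp only [l, dif_neg h, SetLike.coe_mem]
  have hl (f) (u) : c u = l f u • c u := by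
    obtain ⟨ω, hω⟩ := hπ (c u)
    rw [← hω, smul_map_eq_of_mem_fixingSubgroup_compl (hfix f u)]
  let F (f : ∀ u : {u // u ≠ v.fst}, fixingSubgroup A (π ⁻¹' {c u})ᶜ) :
      stabilizer (blowupGroup A S c π) v :=
    ⟨⟨blowupLift π (RelIso.refl S.Adj) (l f) (hl f),
      blowupLift_refl_mem_blowupGroup hc (hl f) (hfix f)⟩,
      Subtype.ext (Prod.ext rfl (show l f v.fst • v.snd = v.snd by simp [l]))⟩
  have hF : Function.Injective F := by
    intro f f' h
    have hll : l f = l f' := blowupLift_refl_injective (hl f) (hl f') (hfix f) (hfix f')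
      (congrArg (fun g => g.1.1) h)
    funext u
    exact Subtype.ext (by simpa [l, u.2] using congrFun hll u)
  have : Finite (blowup S c π ≃g blowup S c π) := DFunLike.finite _
  calc Nat.card (fixingSubgroup A (π ⁻¹' {j})ᶜ) ^ (Nat.card U - 1)
    _ = Nat.card (∀ u : {u // u ≠ v.fst}, fixingSubgroup A (π ⁻¹' {c u})ᶜ) := by
      simp [Nat.card_pi, card_fixingSubgroup_compl_fiber (A := A) (π := π) _ j]
    _ ≤ Nat.card (stabilizer (blowupGroup A S c π) v) := Nat.card_le_card_of_injective F hF

end Blowup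

section Block

open scoped Pointwise

theorem exists_mulActionHom_orbit_of_isBlock {A Ω : Type*} [Group A] [MulAction A Ω]
    [IsPretransitive A Ω] {B : Set Ω} (hB : IsBlock A B) (hne : B.Nonempty) :
    ∃ π : Ω →[A] orbit A B, ∀ C : orbit A B, π ⁻¹' {C} = (C : Set Ω) := by
  have exists_mem (ω : Ω) : ∃ C : orbit A B, ω ∈ (C : Set Ω) := by
    obtain ⟨b, hb⟩ := hne
    obtain ⟨a, rfl⟩ := exists_smul_eq A b ω
    exact ⟨⟨a • B, a, rfl⟩, Set.smul_mem_smul_set hb⟩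
  have eq_of_mem {ω : Ω} {C D : orbit A B} (hC : ω ∈ (C : Set Ω)) (hD : ω ∈ (D : Set Ω)) :
      C = D := by
    obtain ⟨_, a, rfl⟩ := C
    obtain ⟨_, a', rfl⟩ := D
    exact Subtype.ext (hB.smul_eq_smul_of_nonempty ⟨ω, hC, hD⟩)
  choose π hπ using exists_mem
  refine ⟨⟨π, fun a ω => eq_of_mem (hπ _) (Set.smul_mem_smul_set (hπ ω))⟩, fun C => ?_⟩
  ext ω
  exact ⟨fun h => (show π ω = C from h) ▸ hπ ω, fun h => eq_of_mem (hπ ω) h⟩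

theorem exists_isLocallyPair_toPermHom_of_isBlock {A : Type*} {Ω : Type u} [Group A] [MulAction A Ω]
    [FaithfulSMul A Ω] [IsPretransitive A Ω] [Finite Ω] {B : Set Ω} (hB : IsBlock A B)
    (hne : B.Nonempty) (huniv : B ≠ Set.univ) (n : ℕ) :
    ∃ (V : Type u) (Λ : SimpleGraph V) (H : Subgroup (Λ ≃g Λ)),
      IsLocallyPair (toPermHom A Ω).range Λ H ∧ n ≤ Nat.card V ∧
      ∀ v : V, (Nat.card (fixingSubgroup A Bᶜ) : ℝ) ^ ((Nat.card V : ℝ) / B.ncard - 1) ≤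
        Nat.card (stabilizer H v) := by
  obtain ⟨π, hπ⟩ := exists_mulActionHom_orbit_of_isBlock hB hne
  let B₀ : orbit A B := ⟨B, mem_orbit_self B⟩
  have hπB : π ⁻¹' {B₀} = B := hπ B₀
  have hsurj : Function.Surjective π := by
    rintro ⟨_, a, rfl⟩
    obtain ⟨ω, hω⟩ := hne.smul_set (a := a)
    exact ⟨ω, (hπ ⟨a • B, a, rfl⟩).symm.subset hω⟩
  obtain ⟨ω, hω⟩ := (Set.ne_univ_iff_exists_notMem B).1 huniv
  have : Nontrivial (orbit A B) := ⟨π ω, B₀, fun h => hω (hπB.subset h)⟩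
  have : Nonempty Ω := ⟨ω⟩
  obtain ⟨U, S, c, p, _, hU, hc⟩ := exists_isHomogeneousColoring (orbit A B) n
  have hk : 0 < B.ncard := (Set.ncard_pos).2 hne
  have hcard : Nat.card (c.Pullback π) = Nat.card U * B.ncard := by
    rw [card_pullback c π B₀, hπB]
  refine ⟨_, _, _, hc.isLocallyPair_blowupGroup hsurj, ?_, fun v => ?_⟩
  · exact hcard ▸ hU.trans (Nat.le_mul_of_pos_right _ hk)
  have hexp : (Nat.card (c.Pullback π) : ℝ) / B.ncard - 1 = (Nat.card U - 1 : ℕ) := by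
    have := hc.connected.nonempty
    rw [hcard, Nat.cast_mul, mul_div_cancel_right₀ _ (by positivity), Nat.cast_pred Nat.card_pos]
  have hstab := pow_le_card_stabilizer_blowupGroup (A := A) hc.bijOn hsurj B₀ v
  rw [hπB] at hstab
  rw [hexp, Real.rpow_natCast]
  exact_mod_cast hstab

end Block

theorem PermIsomorphic.trans {Ω Δ Θ : Type*} {L : Subgroup (Equiv.Perm Ω)}
    {M : Subgroup (Equiv.Perm Δ)} {N : Subgroup (Equiv.Perm Θ)} (h : PermIsomorphic L M)
    (h' : PermIsomorphic M N) : PermIsomorphic L N := by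
  obtain ⟨e, rfl⟩ := h
  obtain ⟨f, rfl⟩ := h'
  exact ⟨e.trans f, by rw [Subgroup.map_map]; rfl⟩

theorem IsLocallyPair.of_permIsomorphic {Ω Δ V : Type*} {L : Subgroup (Equiv.Perm Ω)}
    {M : Subgroup (Equiv.Perm Δ)} {Γ : SimpleGraph V} {G : Subgroup (Γ ≃g Γ)}
    (h : IsLocallyPair L Γ G) (hLM : PermIsomorphic L M) : IsLocallyPair M Γ G :=
  ⟨h.finite, h.connected, h.vertexTransitive, fun v => (h.local_iso v).trans hLM⟩

theorem permIsomorphic_range_toPermHom {A Ω Δ : Type*} [Group A] [MulAction A Ω] [MulAction A Δ]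
    (e : Ω ≃ Δ) (he : ∀ (a : A) (ω : Ω), e (a • ω) = a • e ω) :
    PermIsomorphic (toPermHom A Ω).range (toPermHom A Δ).range := by
  refine ⟨e, ?_⟩
  rw [MonoidHom.map_range]
  congr 1
  ext a δ
  simp [Equiv.permCongrHom, he]

theorem fixingSubgroup_preimage {A Ω Δ : Type*} [Group A] [MulAction A Ω] [MulAction A Δ]
    {f : Ω →[A] Δ} (hf : Function.Bijective f) (T : Set Δ) :
    fixingSubgroup A (f ⁻¹' T) = fixingSubgroup A T := by
  ext a
  simp only [mem_fixingSubgroup_iff, hf.2.forall, Set.mem_preimage, ← map_smul, hf.1.eq_iff]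

theorem exists_isLocallyPair_of_isBlock {Ω : Type*} [Finite Ω]
    {L : Subgroup (Equiv.Perm Ω)} [IsPretransitive L Ω] {B : Set Ω} (hB : IsBlock L B)
    (hne : B.Nonempty) (huniv : B ≠ Set.univ) (n : ℕ) :
    ∃ (V : Type) (Λ : SimpleGraph V) (H : Subgroup (Λ ≃g Λ)),
      IsLocallyPair L Λ H ∧ n ≤ Nat.card V ∧
      ∀ v : V, (Nat.card (fixingSubgroup L Bᶜ) : ℝ) ^ ((Nat.card V : ℝ) / B.ncard - 1) ≤
        Nat.card (stabilizer H v) := by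
  let f : Shrink.{0} Ω →[L] Ω := ⟨(equivShrink.{0} Ω).symm, equivShrink_symm_smul⟩
  have hf : Function.Bijective f := (equivShrink.{0} Ω).symm.bijective
  have : IsPretransitive L (Shrink.{0} Ω) :=
    (isPretransitive_congr Function.surjective_id hf).2 inferInstance
  have : FaithfulSMul L (Shrink.{0} Ω) := (equivShrink.{0} Ω).symm.faithfulSMul L
  have huniv' : f ⁻¹' B ≠ Set.univ := fun h =>
    huniv (hf.2.preimage_injective (h.trans Set.preimage_univ.symm))
  have hncard : (f ⁻¹' B).ncard = B.ncard :=
    Set.ncard_preimage_of_injective_subset_range hf.1 fun ω _ => hf.2 ω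
  have hL : PermIsomorphic (toPermHom L (Shrink.{0} Ω)).range L := by
    convert permIsomorphic_range_toPermHom (equivShrink.{0} Ω).symm (map_smul f)
    exact L.range_subtype.symm
  obtain ⟨V, Λ, H, hloc, hn, hstab⟩ :=
    exists_isLocallyPair_toPermHom_of_isBlock (hB.preimage f) (hne.preimage hf.2) huniv' n
  rw [← Set.preimage_compl, fixingSubgroup_preimage hf, hncard] at hstab
  exact ⟨V, Λ, H, hloc.of_permIsomorphic hL, hn, hstab⟩

theorem HasExponentialGraphGrowth.of_rpow_le {Ω : Type*} {L : Subgroup (Equiv.Perm Ω)} {K k : ℝ}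
    (hK : 1 < K) (hk : 0 < k) {V : ℕ → Type} {Λ : (n : ℕ) → SimpleGraph (V n)}
    {H : (n : ℕ) → Subgroup (Λ n ≃g Λ n)} (hloc : ∀ n, IsLocallyPair L (Λ n) (H n))
    (hV : Filter.Tendsto (fun n => Nat.card (V n)) Filter.atTop Filter.atTop)
    (hstab : ∀ (n : ℕ) (v : V n),
      K ^ ((Nat.card (V n) : ℝ) / k - 1) ≤ Nat.card (stabilizer (H n) v)) :
    HasExponentialGraphGrowth L := by
  obtain ⟨N, hN⟩ := Filter.eventually_atTop.1 (hV.eventually_ge_atTop ⌈2 * k⌉₊)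
  refine ⟨fun n => V (n + N), fun n => Λ (n + N), fun n => H (n + N), fun n => hloc (n + N),
    hV.comp (Filter.tendsto_add_atTop_nat N), K ^ (1 / (2 * k)),
    Real.one_lt_rpow hK (by positivity), fun n v => le_trans ?_ (hstab (n + N) v)⟩
  rw [← Real.rpow_mul_natCast (by positivity)]
  refine Real.rpow_le_rpow_of_exponent_le hK.le ?_
  have hcard : 2 * k ≤ Nat.card (V (n + N)) := Nat.ceil_le.1 (hN _ (Nat.le_add_left N n))
  have hdiv : 2 ≤ (Nat.card (V (n + N)) : ℝ) / k := by rwa [le_div_iff₀ hk]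
  calc 1 / (2 * k) * (Nat.card (V (n + N)) : ℝ)
    _ = Nat.card (V (n + N)) / k / 2 := by field_simp
    _ ≤ Nat.card (V (n + N)) / k - 1 := by linarith

end GraphGrowth

theorem theorem1p2 {Ω : Type*} [Finite Ω] (L : Subgroup (Equiv.Perm Ω))
    (hL : MulAction.IsPretransitive L Ω) (B : Set Ω) (hB : MulAction.IsBlock L B)
    (hB' : ¬ MulAction.IsTrivialBlock B) (hfix : fixingSubgroup L (Bᶜ) ≠ ⊥) :
    GraphGrowth.HasExponentialGraphGrowth L ∧
    ∃ (V : ℕ → Type) (Λ : (n : ℕ) → SimpleGraph (V n)) (H : (n : ℕ) → Subgroup (Λ n ≃g Λ n)),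
      (∀ n, GraphGrowth.IsLocallyPair L (Λ n) (H n)) ∧
      Filter.Tendsto (fun n => Nat.card (V n)) Filter.atTop Filter.atTop ∧
      ∀ (n : ℕ) (v : V n),
        (Nat.card (fixingSubgroup L (Bᶜ)) : ℝ) ^ ((Nat.card (V n) : ℝ) / (B.ncard : ℝ) - 1) ≤
          (Nat.card (MulAction.stabilizer (H n) v) : ℝ) := by
  obtain ⟨hsub, huniv⟩ := not_or.1 hB'
  have hne : B.Nonempty := (Set.not_subsingleton_iff.1 hsub).nonempty
  choose V Λ H hloc hcard hstab using
    GraphGrowth.exists_isLocallyPair_of_isBlock hB hne huniv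
  have hV : Filter.Tendsto (fun n => Nat.card (V n)) Filter.atTop Filter.atTop :=
    Filter.tendsto_atTop_mono hcard Filter.tendsto_id
  have hK : (1 : ℝ) < Nat.card (fixingSubgroup L Bᶜ) := by
    exact_mod_cast (Subgroup.one_lt_card_iff_ne_bot _).2 hfix
  have hk : (0 : ℝ) < B.ncard := by exact_mod_cast (Set.ncard_pos).2 hne
  exact ⟨.of_rpow_le hK hk hloc hV hstab, V, Λ, H, hloc, hV, hstab⟩
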